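/- For a symmetric matrix $B\in\mathbb R^{n\times n}$ let the node support $I_B\subseteq[n]$ be an index set of smallest cardinality such that every row $B_{i,\cdot}$ with $i\in I_B$ is nonzero and $B_{ij}=0$ for all $i,j\notin I_B$, and let $\eta(B)\in\{0,1\}^n$ be the indicator vector of $I_B$. For $b\ge 0$ and integers $n,m$ let $\mathcal B_S(b,n,m)$ be the set of symmetric $B\in\mathbb R^{n\times n}$ such that $|I_B|\le m$; for every $i\in I_B$, $\big\|(B_{ij})_{j\in([n]\setminus I_B)\cup\{i\}}\big\|_2\ge b$ and the row $B_{i,\cdot}$ has at least $m+1$ nonzero entries; and $B_{ij}=0$ for all $i,j\notin I_B$. (For such $B$ the set $I_B$ is unique.) For $N\ge 1$ and $\sigma>0$ suppose we observe $Y_\ell=B+W_\ell$, $\ell=1,\dots,N$, where $W_1,\dots,W_N$ are independent symmetric $n\times n$ matrices whose entries $W_{\ell,ij}$, $1\le i\le j\le n$, are i.i.d. $\mathcal N(0,\sigma^2)$. Let $$R_N(b,\sigma,n,m)=\inf_{\hat\eta}\ \sup_{B\in\mathcal B_S(b,n,m)}\mathbb E_B\sum_{i=1}^n|\hat\eta_i-\eta_i(B)|,$$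 where the infimum is over measurable functions $\hat\eta$ of $(Y_1,\dots,Y_N)$ with values in $[0,1]^n$. For $C'>0$ put $$f_n(a,m')=3-\frac{m'}{n}\left(\exp\Big\{a-C'n\log\frac{n}{3m'}\Big\}+\exp\Big\{\frac{a}{\log n}-C'n\Big\}+\exp\Big\{\frac{C'a}{n}\Big\}\right).$$ 1. There are universal constants $C,C'>0$ such that for all sufficiently large $n$ (larger than a universal constant), all integers $m\ge 0$ with $m<n/3$, all $b\ge 0$ and $\sigma>0$, and every real $m'\in(0,m]$, $$R_1(b,\sigma,n,m)\ \ge\ 4m'\left[\frac1{16}f_n\Big(\frac{Cb^4}{\sigma^4},m'\Big)-e^{-(m-m')^2/(2m)}\right].$$ 2. There is a universal constant $C>0$ such that for all integers $n,m\ge 0$ with $m<n/3$, all $b\ge 0$ and $\sigma>0$, and every real $m'\in[1,m]$, if $b<C\sigma n^{1/4}\log^{1/4}\big(n/(3m')\big)$, then $$R_1(b,\sigma,n,m)\ \ge\ 4m'\left[\frac18-e^{-(m-m')^2/(2m)}\right].$$ 3. There is a universal constant $C>0$ such that for all sufficiently large $n$ (larger than a universal constant), all integers $m\ge 0$ with $m<n/3$,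 all $N\ge 1$, $b\ge 0$ and $\sigma>0$, and every real $m'\in[1,m]$, if $b<C\sigma n^{1/4}\log^{1/4}\big(n/(3m')\big)/\sqrt N$, then $$R_N(b,\sigma,n,m)\ \ge\ 4m'\left[\frac18-e^{-(m-m')^2/(2m)}\right].$$ -/

import Mathlib

open MeasureTheory ProbabilityTheory
open scoped ENNReal

/-- The index set `I` satisfies the node-sparsity condition for the symmetric matrix `B`: every row
indexed by `I` has positive Euclidean norm (for symmetric `B` this is also the norm of the
corresponding column), and `B` vanishes on `Iᶜ × Iᶜ`. -/
def IsNodeCover {n : ℕ} (B : Matrix (Fin n) (Fin n) ℝ) (I : Finset (Fin n)) : Prop :=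
  (∀ i ∈ I, 0 < √(∑ j, B i j ^ 2)) ∧ ∀ i ∉ I, ∀ j ∉ I, B i j = 0

theorem exists_smallest_nodeCover {n : ℕ} (B : Matrix (Fin n) (Fin n) ℝ) :
    ∃ I, IsNodeCover B I ∧ ∀ J, IsNodeCover B J → I.card ≤ J.card := by
  classical
  have hne : {I : Finset (Fin n) | IsNodeCover B I}.Nonempty := by
    refine ⟨Finset.univ.filter fun i => 0 < √(∑ j, B i j ^ 2), ?_, ?_⟩
    · intro i hi
      exact (Finset.mem_filter.1 hi).2
    · intro i hi j _
      by_contra hij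
      refine hi (Finset.mem_filter.2 ⟨Finset.mem_univ i, Real.sqrt_pos.2 ?_⟩)
      exact Finset.sum_pos' (fun k _ => sq_nonneg _) ⟨j, Finset.mem_univ j, by positivity⟩
  obtain ⟨I, hI, hmin⟩ :=
    Set.exists_min_image {I : Finset (Fin n) | IsNodeCover B I} Finset.card (Set.toFinite _) hne
  exact ⟨I, hI, hmin⟩

/-- The node support `I_B`: an index set of smallest cardinality satisfying the node-sparsity
condition. (On the class `nodeSparse` below it is the only such set, see
`nodeSupport_eq_of_rows`.) -/
noncomputable def nodeSupport {n : ℕ} (B : Matrix (Fin n) (Fin n) ℝ) : Finset (Fin n) :=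
  (exists_smallest_nodeCover B).choose

theorem nodeSupport_spec {n : ℕ} (B : Matrix (Fin n) (Fin n) ℝ) :
    IsNodeCover B (nodeSupport B) ∧ ∀ J, IsNodeCover B J → (nodeSupport B).card ≤ J.card :=
  (exists_smallest_nodeCover B).choose_spec

/-- If `I` has at most `m` elements, satisfies the node-sparsity condition, and every row indexed by
`I` has at least `m + 1` nonzero entries, then `I` is the node support. -/
theorem nodeSupport_eq_of_rows {n m : ℕ} {B : Matrix (Fin n) (Fin n) ℝ} {I : Finset (Fin n)}
    (hI : IsNodeCover B I) (hm : I.card ≤ m)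
    (hrow : ∀ i ∈ I, m + 1 ≤ (Finset.univ.filter fun j => B i j ≠ 0).card) :
    nodeSupport B = I := by
  classical
  obtain ⟨hc, hmin⟩ := nodeSupport_spec B
  have hle := hmin I hI
  refine (Finset.eq_of_subset_of_card_le (fun i hi => ?_) hle).symm
  by_contra hiJ
  have hsub : (Finset.univ.filter fun j => B i j ≠ 0) ⊆ nodeSupport B := by
    intro j hj
    by_contra hjJ
    exact (Finset.mem_filter.1 hj).2 (hc.2 i hiJ j hjJ)
  have h1 := Finset.card_le_card hsub
  have h2 := hrow i hi
  omega

/-- The parameter set `𝓑_S(b, n, m)`: symmetric `n × n` matrices `B` with `|I_B| ≤ m` such that, for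
every `i ∈ I_B`, the vector `(B i j)` with `j` ranging over `([n] \ I_B) ∪ {i}` has Euclidean norm at
least `b` and row `i` has at least `m + 1` nonzero entries, while `B` vanishes on `I_Bᶜ × I_Bᶜ`. -/
def nodeSparse (b : ℝ) (n m : ℕ) : Set (Matrix (Fin n) (Fin n) ℝ) :=
  {B | B.IsSymm ∧ (nodeSupport B).card ≤ m ∧
    (∀ i ∈ nodeSupport B, b ≤ √(∑ j ∈ insert i (nodeSupport B)ᶜ, B i j ^ 2)) ∧
    (∀ i ∈ nodeSupport B, m + 1 ≤ (Finset.univ.filter fun j => B i j ≠ 0).card) ∧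
    ∀ i ∉ nodeSupport B, ∀ j ∉ nodeSupport B, B i j = 0}

/-- The binary support indicator `η` of `B`. -/
noncomputable def supportIndicator {n : ℕ} (B : Matrix (Fin n) (Fin n) ℝ) (i : Fin n) : ℝ :=
  if i ∈ nodeSupport B then 1 else 0

/-- The law of `Y = B + W`, where `W` is symmetric with i.i.d. `N(0, σ²)` entries on and above the
diagonal: there is one Gaussian variable `g s(i, j)` for each unordered pair `s(i, j)`, `i = j`
allowed, and `W i j = g s(i, j)`. -/
noncomputable def observationLaw {n : ℕ} (σ : ℝ) (B : Matrix (Fin n) (Fin n) ℝ) :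
    Measure (Fin n → Fin n → ℝ) :=
  (Measure.pi fun _ : Sym2 (Fin n) => gaussianReal 0 (σ ^ 2).toNNReal).map
    fun g i j => B i j + g s(i, j)

/-- The joint law of `N` independent copies of `Y`. -/
noncomputable def samplesLaw {n : ℕ} (N : ℕ) (σ : ℝ) (B : Matrix (Fin n) (Fin n) ℝ) :
    Measure (Fin N → Fin n → Fin n → ℝ) :=
  Measure.pi fun _ => observationLaw σ B

/-- Estimators of the support indicator: measurable functions of the data with values in
`[0, 1] ^ n`. -/
def Estimator (𝒴 : Type) [MeasurableSpace 𝒴] (n : ℕ) : Type :=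
  {T : 𝒴 → Fin n → ℝ // Measurable T ∧ ∀ y i, T y i ∈ Set.Icc (0 : ℝ) 1}

/-- The Hamming distance `∑ |x i - y i|`. -/
def hammingLoss {n : ℕ} (x y : Fin n → ℝ) : ℝ := ∑ i, |x i - y i|

/-- The minimax expected Hamming error `inf_T sup_{B ∈ S} E_B ‖T - η(B)‖_H`, when the data have law
`P B` under the parameter `B`. -/
noncomputable def hammingMinimaxRisk {n : ℕ} {𝒴 : Type} [MeasurableSpace 𝒴]
    (P : Matrix (Fin n) (Fin n) ℝ → Measure 𝒴) (S : Set (Matrix (Fin n) (Fin n) ℝ)) : ℝ≥0∞ :=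
  ⨅ T : Estimator 𝒴 n, ⨆ B ∈ S,
    ∫⁻ y, ENNReal.ofReal (hammingLoss (T.1 y) (supportIndicator B)) ∂P B

/-- The function `f_n(a, m')`, for a given value of the constant `C'`. -/
noncomputable def fRate (C' : ℝ) (n : ℕ) (a m' : ℝ) : ℝ :=
  3 - m' / n * (Real.exp (a - C' * n * Real.log (n / (3 * m')))
    + Real.exp (a / Real.log n - C' * n) + Real.exp (C' * a / n))

/-! The minimax risk is bounded below by a Bayes risk. Choose a random node set `S` by including
each node independently with probability `p = m' / n`, and give every edge meeting `S` (loops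
included) mean `± β` with independent fair signs. Taking `β² ≥ 3b² / (2n)` with `β ≠ 0` places every
such matrix with `|S| ≤ m` in the class, because each row of `S` has more than `2n/3` relevant
entries.

Given `t = S \ {i}`, deciding whether `i ∈ S` is a binary test. Averaging over signs makes the
densities products over edges, so the likelihood ratio `L` involves only the at most `n` edges that
`i` adds, and its second moment given `t` is at most `cosh (N β² / σ²) ^ n ≤ exp (n N² β⁴ / (2σ⁴))`.
Then `min (p L) (1 - p) ≥ p L - (p L)² / (4 (1 - p))` bounds the testing risk
(`le_bayes_testing_risk`).

Summing over `i` and discarding sets with more than `m` nodes (`mul_sum_le_of_forall_hamming_le`)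
costs only a Chernoff factor `1 - exp (-(m - m')² / (2m))`. The choice of `β` then yields all three
bounds, with no lower limit on `n`. -/

/-- A product of probability measures given by real densities has the product density. -/
theorem pi_eq_withDensity_prod {ι E : Type*} [Fintype ι] [MeasurableSpace E] {μ ν : ι → Measure E}
    [∀ i, IsProbabilityMeasure (μ i)] [∀ i, IsProbabilityMeasure (ν i)] {f : ι → E → ℝ}
    (h0 : ∀ i x, 0 ≤ f i x) (hf : ∀ i, Integrable (f i) (μ i))
    (hν : ∀ i, ν i = (μ i).withDensity fun x => ENNReal.ofReal (f i x)) :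
    Measure.pi ν = (Measure.pi μ).withDensity fun x => ENNReal.ofReal (∏ i, f i (x i)) := by
  refine Measure.pi_eq fun s hs => ?_
  rw [withDensity_apply _ (MeasurableSet.univ_pi hs), Measure.restrict_pi_pi,
    ← ofReal_integral_eq_lintegral_ofReal
      (Integrable.fintype_prod fun i => (hf i).mono_measure Measure.restrict_le_self)
      (Filter.Eventually.of_forall fun x => Finset.prod_nonneg fun i _ => h0 i _),
    integral_fintype_prod_eq_prod, ENNReal.ofReal_prod_of_nonneg
      (fun i _ => integral_nonneg fun x => h0 i x)]
  refine Finset.prod_congr rfl fun i _ => ?_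
  rw [hν, withDensity_apply _ (hs i), ofReal_integral_eq_lintegral_ofReal (hf i).restrict
    (Filter.Eventually.of_forall fun x => h0 i x)]

open scoped NNReal in
theorem gaussianReal_eq_withDensity_exp {v : ℝ≥0} (hv : v ≠ 0) (t : ℝ) :
    gaussianReal t v = (gaussianReal 0 v).withDensity
      fun x => ENNReal.ofReal (Real.exp (t * x / v - t ^ 2 / (2 * v))) := by
  have hv' : (v : ℝ) ≠ 0 := by exact_mod_cast hv
  rw [gaussianReal_of_var_ne_zero _ hv, gaussianReal_of_var_ne_zero _ hv,
    ← withDensity_mul _ (measurable_gaussianPDF _ _) (by fun_prop)]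
  congr 1
  ext x
  simp only [Pi.mul_apply, gaussianPDF]
  rw [← ENNReal.ofReal_mul (gaussianPDFReal_nonneg _ _ _), gaussianPDFReal, gaussianPDFReal,
    mul_assoc _ (Real.exp (-(x - 0) ^ 2 / (2 * v))), ← Real.exp_add]
  congr 3
  field_simp
  ring

open scoped NNReal in
theorem integrable_exp_shift {v : ℝ≥0} (hv : v ≠ 0) (t : ℝ) :
    Integrable (fun x => Real.exp (t * x / v - t ^ 2 / (2 * v))) (gaussianReal 0 v) := by
  have h := gaussianReal_eq_withDensity_exp hv t
  refine ⟨by fun_prop, ?_⟩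
  rw [hasFiniteIntegral_iff_ofReal (Filter.Eventually.of_forall fun x => (Real.exp_pos _).le),
    ← setLIntegral_univ, ← withDensity_apply _ MeasurableSet.univ, ← h, measure_univ]
  exact ENNReal.one_lt_top

/-! ### Gaussian shifts: likelihood ratios and their second moments. -/

section Noise

open scoped NNReal

variable {E : Type*} [Fintype E]

/-- `N` independent families of i.i.d. centred Gaussian variables of variance `v`, indexed by `E`. -/
noncomputable def noise (N : ℕ) (E : Type*) [Fintype E] (v : ℝ≥0) : Measure (Fin N → E → ℝ) :=
  Measure.pi fun _ => Measure.pi fun _ => gaussianReal 0 v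

instance (N : ℕ) (v : ℝ≥0) : IsProbabilityMeasure (noise N E v) := by
  unfold noise; infer_instance

/-- The density of the family with mean `θ` with respect to the centred one. -/
noncomputable def shiftDensity {N : ℕ} (v : ℝ≥0) (θ : E → ℝ) (y : Fin N → E → ℝ) : ℝ :=
  ∏ l, ∏ e, Real.exp (θ e * y l e / v - θ e ^ 2 / (2 * v))

theorem shiftDensity_pos {N : ℕ} (v : ℝ≥0) (θ : E → ℝ) (y : Fin N → E → ℝ) :
    0 < shiftDensity v θ y :=
  Finset.prod_pos fun _ _ => Finset.prod_pos fun _ _ => Real.exp_pos _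

@[fun_prop]
theorem measurable_shiftDensity {N : ℕ} (v : ℝ≥0) (θ : E → ℝ) :
    Measurable (shiftDensity v θ : (Fin N → E → ℝ) → ℝ) := by
  unfold shiftDensity; fun_prop

theorem integrable_shiftDensity {N : ℕ} {v : ℝ≥0} (hv : v ≠ 0) (θ : E → ℝ) :
    Integrable (shiftDensity v θ) (noise N E v) := by
  refine Integrable.fintype_prod (f := fun _ (x : E → ℝ) =>
    ∏ e, Real.exp (θ e * x e / v - θ e ^ 2 / (2 * v))) fun l => ?_
  exact Integrable.fintype_prod (f := fun e x => Real.exp (θ e * x / v - θ e ^ 2 / (2 * v)))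
    fun e => integrable_exp_shift hv _

theorem pi_gaussianReal_eq_withDensity {N : ℕ} {v : ℝ≥0} (hv : v ≠ 0) (θ : E → ℝ) :
    (Measure.pi fun _ : Fin N => Measure.pi fun e => gaussianReal (θ e) v) =
      (noise N E v).withDensity fun y => ENNReal.ofReal (shiftDensity v θ y) := by
  refine pi_eq_withDensity_prod (f := fun _ (x : E → ℝ) =>
    ∏ e, Real.exp (θ e * x e / v - θ e ^ 2 / (2 * v)))
    (fun _ _ => Finset.prod_nonneg fun _ _ => (Real.exp_pos _).le) (fun _ => ?_) fun _ => ?_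
  · exact Integrable.fintype_prod (f := fun e x => Real.exp (θ e * x / v - θ e ^ 2 / (2 * v)))
      fun e => integrable_exp_shift hv _
  · exact pi_eq_withDensity_prod
      (f := fun e x => Real.exp (θ e * x / v - θ e ^ 2 / (2 * v)))
      (fun _ _ => (Real.exp_pos _).le) (fun _ => integrable_exp_shift hv _)
      fun _ => gaussianReal_eq_withDensity_exp hv _

theorem integral_pi_gaussianReal {N : ℕ} {v : ℝ≥0} (hv : v ≠ 0) (θ : E → ℝ)
    (F : (Fin N → E → ℝ) → ℝ) :
    ∫ y, F y ∂(Measure.pi fun _ : Fin N => Measure.pi fun e => gaussianReal (θ e) v) =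
      ∫ y, F y * shiftDensity v θ y ∂noise N E v := by
  rw [pi_gaussianReal_eq_withDensity hv, integral_withDensity_eq_integral_toReal_smul
    (by fun_prop) (Filter.Eventually.of_forall fun _ => ENNReal.ofReal_lt_top)]
  refine integral_congr_ae (Filter.Eventually.of_forall fun y => ?_)
  simp [ENNReal.toReal_ofReal (shiftDensity_pos v θ y).le, mul_comm]

theorem integral_shiftDensity {N : ℕ} {v : ℝ≥0} (hv : v ≠ 0) (θ : E → ℝ) :
    ∫ y, shiftDensity v θ y ∂noise N E v = 1 := by
  have h := integral_pi_gaussianReal (N := N) hv θ fun _ => 1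
  simpa using h.symm

/-- Expanding `(θ + θ')²` leaves only the cross term, so mixed second moments reduce to the
normalisation of a single shift. -/
theorem shiftDensity_mul {N : ℕ} {v : ℝ≥0} (hv : v ≠ 0) (θ θ' : E → ℝ) (y : Fin N → E → ℝ) :
    shiftDensity v θ y * shiftDensity v θ' y =
      (∏ e, Real.exp (N * (θ e * θ' e) / v)) * shiftDensity v (θ + θ') y := by
  have hv' : (v : ℝ) ≠ 0 := by exact_mod_cast hv
  have h : ∏ e, Real.exp (N * (θ e * θ' e) / v) =
      ∏ _l : Fin N, ∏ e, Real.exp (θ e * θ' e / v) := by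
    rw [Finset.prod_const, ← Finset.prod_pow]
    refine Finset.prod_congr rfl fun e _ => ?_
    rw [← Real.exp_nat_mul]; simp [mul_div_assoc]
  rw [h, shiftDensity, shiftDensity, shiftDensity, ← Finset.prod_mul_distrib,
    ← Finset.prod_mul_distrib]
  refine Finset.prod_congr rfl fun l _ => ?_
  rw [← Finset.prod_mul_distrib, ← Finset.prod_mul_distrib]
  refine Finset.prod_congr rfl fun e _ => ?_
  rw [← Real.exp_add, ← Real.exp_add]
  congr 1
  simp only [Pi.add_apply]
  field_simp
  ring

theorem integrable_shiftDensity_mul {N : ℕ} {v : ℝ≥0} (hv : v ≠ 0) (θ θ' : E → ℝ) :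
    Integrable (fun y => shiftDensity v θ y * shiftDensity v θ' y) (noise N E v) := by
  simp only [shiftDensity_mul hv]
  exact (integrable_shiftDensity hv _).const_mul _

theorem integral_shiftDensity_mul {N : ℕ} {v : ℝ≥0} (hv : v ≠ 0) (θ θ' : E → ℝ) :
    ∫ y, shiftDensity v θ y * shiftDensity v θ' y ∂noise N E v =
      ∏ e, Real.exp (N * (θ e * θ' e) / v) := by
  simp only [shiftDensity_mul hv]
  rw [integral_const_mul, integral_shiftDensity hv, mul_one]

end Noise

/-! ### Random signs and the two-point testing bound. -/

section Signs

open scoped NNReal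

variable {E : Type*} [Fintype E] [DecidableEq E]

/-- The average of `F` over all assignments of signs. -/
noncomputable def signAverage (F : (E → Bool) → ℝ) : ℝ :=
  (1 / 2) ^ Fintype.card E * ∑ ε, F ε

theorem signAverage_prod (f : E → Bool → ℝ) :
    signAverage (fun ε => ∏ e, f e (ε e)) = ∏ e, (f e true + f e false) / 2 := by
  have h := Finset.prod_univ_sum (fun _ : E => (Finset.univ : Finset Bool)) f
  rw [Fintype.piFinset_univ] at h
  rw [signAverage, ← h, Finset.prod_div_distrib, Finset.prod_const, Finset.card_univ]
  simp only [Fintype.sum_bool, one_div, inv_pow]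
  ring

theorem signAverage_const (c : ℝ) : signAverage (fun _ : E → Bool => c) = c := by
  simp only [signAverage, Finset.sum_const, Finset.card_univ, Fintype.card_pi, Fintype.card_bool,
    Finset.prod_const, nsmul_eq_mul, Nat.cast_pow, Nat.cast_ofNat]
  rw [← mul_assoc, ← mul_pow]; norm_num

theorem signAverage_mul_const (F : (E → Bool) → ℝ) (c : ℝ) :
    signAverage F * c = signAverage fun ε => F ε * c := by
  simp only [signAverage, mul_assoc, Finset.sum_mul]

theorem const_mul_signAverage (F : (E → Bool) → ℝ) (c : ℝ) :
    c * signAverage F = signAverage fun ε => c * F ε := by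
  simp only [mul_comm c, signAverage_mul_const]

theorem signAverage_le {F : (E → Bool) → ℝ} {r : ℝ} (h : ∀ ε, F ε ≤ r) : signAverage F ≤ r := by
  rw [← signAverage_const (E := E) r]
  exact mul_le_mul_of_nonneg_left (Finset.sum_le_sum fun ε _ => h ε) (by positivity)

theorem integrable_signAverage {α : Type*} [MeasurableSpace α] {μ : Measure α}
    {F : (E → Bool) → α → ℝ} (h : ∀ ε, Integrable (F ε) μ) :
    Integrable (fun y => signAverage fun ε => F ε y) μ :=
  (integrable_finsetSum _ fun ε _ => h ε).const_mul _

theorem integral_signAverage {α : Type*} [MeasurableSpace α] {μ : Measure α}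
    {F : (E → Bool) → α → ℝ} (h : ∀ ε, Integrable (F ε) μ) :
    ∫ y, signAverage (fun ε => F ε y) ∂μ = signAverage fun ε => ∫ y, F ε y ∂μ := by
  simp only [signAverage]
  rw [integral_const_mul, integral_finsetSum _ fun ε _ => h ε]

/-- The mean equal to `± β` on `A`, with signs given by `ε`, and to zero off `A`. -/
noncomputable def signedMean (β : ℝ) (A : Finset E) (ε : E → Bool) (e : E) : ℝ :=
  if e ∈ A then (if ε e then β else -β) else 0

/-- The density, for uniformly random signs, of the mixture of the families with mean `± β` on `A`
and zero off `A`. -/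
noncomputable def mixtureDensity {N : ℕ} (v : ℝ≥0) (β : ℝ) (A : Finset E) (y : Fin N → E → ℝ) : ℝ :=
  signAverage fun ε => shiftDensity v (signedMean β A ε) y

/-- Independent signs make the edges independent under the mixture. This gives nonnegativity and, on
disjoint sets, multiplicativity, so the likelihood ratio of `A ∪ A'` to `A` is the mixture density
of `A'`. -/
theorem mixtureDensity_eq_prod {N : ℕ} (v : ℝ≥0) (β : ℝ) (A : Finset E) (y : Fin N → E → ℝ) :
    mixtureDensity v β A y = ∏ e ∈ A, ((∏ l, Real.exp (β * y l e / v - β ^ 2 / (2 * v))) +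
      ∏ l, Real.exp (-β * y l e / v - (-β) ^ 2 / (2 * v))) / 2 := by
  have h := signAverage_prod (E := E) fun e s => ∏ l,
    Real.exp ((if e ∈ A then (if s then β else -β) else 0) * y l e / v -
      (if e ∈ A then (if s then β else -β) else 0) ^ 2 / (2 * v))
  simp only [mixtureDensity, shiftDensity]
  simp_rw [Finset.prod_comm (s := (Finset.univ : Finset (Fin N)))]
  refine Eq.trans h ?_
  rw [← Finset.prod_subset (Finset.subset_univ A)]
  · refine Finset.prod_congr rfl fun e he => ?_
    simp [he]
  · intro e _ he
    simp [he]

theorem mixtureDensity_nonneg {N : ℕ} (v : ℝ≥0) (β : ℝ) (A : Finset E) (y : Fin N → E → ℝ) :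
    0 ≤ mixtureDensity v β A y := by
  rw [mixtureDensity_eq_prod]
  exact Finset.prod_nonneg fun e _ => by positivity

theorem mixtureDensity_union {N : ℕ} (v : ℝ≥0) (β : ℝ) {A A' : Finset E} (h : Disjoint A A')
    (y : Fin N → E → ℝ) :
    mixtureDensity v β (A ∪ A') y = mixtureDensity v β A y * mixtureDensity v β A' y := by
  simp only [mixtureDensity_eq_prod, Finset.prod_union h]

theorem integrable_mixtureDensity {N : ℕ} {v : ℝ≥0} (hv : v ≠ 0) (β : ℝ) (A : Finset E) :
    Integrable (mixtureDensity v β A) (noise N E v) :=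
  integrable_signAverage fun _ => integrable_shiftDensity hv _

theorem integral_mixtureDensity {N : ℕ} {v : ℝ≥0} (hv : v ≠ 0) (β : ℝ) (A : Finset E) :
    ∫ y, mixtureDensity v β A y ∂noise N E v = 1 := by
  simp only [mixtureDensity]
  rw [integral_signAverage fun _ => integrable_shiftDensity hv _]
  simp only [integral_shiftDensity hv, signAverage_const]

theorem mixtureDensity_mul_eq {N : ℕ} (v : ℝ≥0) (β : ℝ) (A A' : Finset E) (y : Fin N → E → ℝ) :
    mixtureDensity v β A y * mixtureDensity v β A' y = signAverage fun ε' => signAverage fun ε =>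
      shiftDensity v (signedMean β A ε) y * shiftDensity v (signedMean β A' ε') y := by
  rw [mixtureDensity, mixtureDensity, const_mul_signAverage]
  simp only [signAverage_mul_const]

theorem integrable_mixtureDensity_mul {N : ℕ} {v : ℝ≥0} (hv : v ≠ 0) (β : ℝ) (A A' : Finset E) :
    Integrable (fun y => mixtureDensity v β A y * mixtureDensity v β A' y) (noise N E v) := by
  simp only [mixtureDensity_mul_eq]
  exact integrable_signAverage fun _ => integrable_signAverage fun _ =>
    integrable_shiftDensity_mul hv _ _

theorem integral_mixtureDensity_mul {N : ℕ} {v : ℝ≥0} (hv : v ≠ 0) (β : ℝ) {A A' : Finset E}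
    (h : A' ⊆ A) :
    ∫ y, mixtureDensity v β A y * mixtureDensity v β A' y ∂noise N E v =
      Real.cosh (N * β ^ 2 / v) ^ A'.card := by
  simp only [mixtureDensity_mul_eq]
  rw [integral_signAverage fun _ => integrable_signAverage fun _ =>
    integrable_shiftDensity_mul hv _ _]
  -- For each fixed `ε'` the average over `ε` already equals the power of `cosh`: on `A'` the
  -- exponent is `± N β² / v` with equal weights, and elsewhere it vanishes. The outer average is
  -- therefore that of a constant.
  rw [← signAverage_const (E := E) (Real.cosh _ ^ _)]
  congr 1
  ext ε'
  rw [integral_signAverage fun _ => integrable_shiftDensity_mul hv _ _]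
  simp only [integral_shiftDensity_mul hv]
  have key := signAverage_prod (E := E) fun e s =>
    Real.exp (N * ((if e ∈ A then (if s then β else -β) else 0) * signedMean β A' ε' e) / v)
  refine Eq.trans key ?_
  rw [← Finset.prod_subset (Finset.subset_univ A'), ← Finset.prod_const]
  · refine Finset.prod_congr rfl fun e he => ?_
    rw [Real.cosh_eq]
    cases h' : ε' e <;> simp [signedMean, he, h he, h', neg_div, ← sq, add_comm]
  · intro e _ he
    simp [signedMean, he]

/-- A lower bound for the Bayes risk of testing, with prior probability `p` of the larger set,
whether the mean is `± β` on `A ∪ A'` or only on `A`. -/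
theorem le_bayes_testing_risk {N : ℕ} {v : ℝ≥0} (hv : v ≠ 0) (β : ℝ) {A A' : Finset E}
    (hA : Disjoint A A') {p : ℝ} (hp1 : p < 1) {f : (Fin N → E → ℝ) → ℝ}
    (hf : Measurable f) (h01 : ∀ y, f y ∈ Set.Icc (0 : ℝ) 1) :
    p - p ^ 2 / (4 * (1 - p)) * Real.cosh (N * β ^ 2 / v) ^ A'.card ≤
      p * ∫ y, (1 - f y) * mixtureDensity v β (A ∪ A') y ∂noise N E v +
        (1 - p) * ∫ y, f y * mixtureDensity v β A y ∂noise N E v := by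
  have hq : 0 < 1 - p := by linarith
  have i1 : Integrable (fun y => (1 - f y) * mixtureDensity v β (A ∪ A') y) (noise N E v) := by
    refine (integrable_mixtureDensity hv β _).bdd_mul (c := 1) (by fun_prop)
      (Filter.Eventually.of_forall fun y => ?_)
    rw [Real.norm_eq_abs, abs_le]
    constructor <;> linarith [(h01 y).1, (h01 y).2]
  have i2 : Integrable (fun y => f y * mixtureDensity v β A y) (noise N E v) := by
    refine (integrable_mixtureDensity hv β _).bdd_mul (c := 1) (by fun_prop)
      (Filter.Eventually.of_forall fun y => ?_)
    rw [Real.norm_eq_abs, abs_le]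
    constructor <;> linarith [(h01 y).1, (h01 y).2]
  have i3 := integrable_mixtureDensity (N := N) hv β (A ∪ A')
  have i4 := integrable_mixtureDensity_mul (N := N) hv β (A ∪ A') A'
  -- With `D` and `L` the densities for `A` and `A'`, the density for `A ∪ A'` is `D L`. The power
  -- of `cosh` is thus the integral of `D L²`, and the claim becomes a pointwise inequality with
  -- common factor `D`.
  rw [← integral_const_mul, ← integral_const_mul, ← integral_add (i1.const_mul _) (i2.const_mul _),
    ← integral_mixtureDensity_mul hv β (Finset.subset_union_right (s₁ := A))]
  have hp : p = ∫ y, p * mixtureDensity v β (A ∪ A') y ∂noise N E v := by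
    rw [integral_const_mul, integral_mixtureDensity hv, mul_one]
  refine (congrArg (· - _) hp).le.trans ?_
  rw [← integral_const_mul, ← integral_sub (i3.const_mul _) (i4.const_mul _)]
  refine integral_mono ((i3.const_mul _).sub (i4.const_mul _))
    ((i1.const_mul _).add (i2.const_mul _)) fun y => ?_
  have hD := mixtureDensity_nonneg v β A y
  have hL := mixtureDensity_nonneg v β A' y
  obtain ⟨f0, f1⟩ := h01 y
  simp only [mixtureDensity_union v β hA]
  set D := mixtureDensity v β A y
  set L := mixtureDensity v β A' y
  suffices h : p * L - p ^ 2 / (4 * (1 - p)) * L ^ 2 ≤ p * ((1 - f y) * L) + (1 - p) * f y by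
    have := mul_le_mul_of_nonneg_left h hD
    linarith
  have h4 : 0 ≤ p ^ 2 / (4 * (1 - p)) * L ^ 2 := by positivity
  -- The right side is at least `min (p L) (1 - p)`. When the minimum is `1 - p`, completing the
  -- square in `p L` suffices.
  rcases le_total (p * L) (1 - p) with h | h
  · nlinarith
  · have h5 : p * L - p ^ 2 / (4 * (1 - p)) * L ^ 2 ≤ 1 - p := by
      have : 1 - p - (p * L - p ^ 2 / (4 * (1 - p)) * L ^ 2) =
          (2 * (1 - p) - p * L) ^ 2 / (4 * (1 - p)) := by
        field_simp; ring
      have h6 : 0 ≤ (2 * (1 - p) - p * L) ^ 2 / (4 * (1 - p)) := by positivity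
      linarith
    nlinarith

end Signs

/-! ### Binomial tails and truncation of the prior. -/

theorem log_le_of_le_one {x : ℝ} (h0 : 0 < x) (h1 : x ≤ 1) : Real.log x ≤ x - 1 - (1 - x) ^ 2 / 2 := by
  have h := sum_le_hasSum (Finset.range 2)
    (fun k _ => div_nonneg (pow_nonneg (sub_nonneg.2 h1) (k + 1)) k.cast_add_one_pos.le)
    (Real.hasSum_pow_div_log_of_abs_lt_one (x := 1 - x) (by rw [abs_lt]; constructor <;> linarith))
  norm_num [Finset.sum_range_succ] at h
  linarith

/-- Chernoff's bound for the upper tail of a binomial distribution of mean at most `μ`. -/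
theorem one_sub_exp_le_sum_powerset {ι : Type*} (s : Finset ι) {p μ : ℝ} {m : ℕ} (hp0 : 0 ≤ p)
    (hp1 : p ≤ 1) (hμ0 : 0 < μ) (hμ : s.card * p ≤ μ) (hμm : μ ≤ m) :
    1 - Real.exp (-(m - μ) ^ 2 / (2 * m)) ≤
      ∑ t ∈ s.powerset with t.card < m, p ^ t.card * (1 - p) ^ (s.card - t.card) := by
  have hm : (0 : ℝ) < m := hμ0.trans_le hμm
  have hq : 0 ≤ 1 - p := by linarith
  -- Exponential tilting: for `|t| ≥ m` the factor `x ^ m / x ^ |t|` is at least one, so it may be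
  -- inserted in the tail sum.
  set x : ℝ := μ / m with hx
  have hx0 : 0 < x := by positivity
  have hx1 : x ≤ 1 := (div_le_one hm).2 hμm
  have h1 := Finset.sum_pow_mul_eq_add_pow p (1 - p) s
  have h2 := Finset.sum_pow_mul_eq_add_pow (p / x) (1 - p) s
  rw [add_sub_cancel, one_pow, ← Finset.sum_filter_add_sum_filter_not _ (fun t => t.card < m)] at h1
  have h3 : ∑ t ∈ s.powerset with ¬ t.card < m, p ^ t.card * (1 - p) ^ (s.card - t.card) ≤
      x ^ m * (p / x + (1 - p)) ^ s.card := by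
    rw [← h2, Finset.mul_sum]
    refine (Finset.sum_le_sum fun t ht => ?_).trans (Finset.sum_le_sum_of_subset_of_nonneg
      (Finset.filter_subset _ _) fun t _ _ => by positivity)
    have ht' : m ≤ t.card := not_lt.1 (Finset.mem_filter.1 ht).2
    rw [← mul_assoc]
    refine mul_le_mul_of_nonneg_right ?_ (by positivity)
    rw [div_pow p x, ← mul_div_assoc, le_div_iff₀ (by positivity), mul_comm (x ^ m)]
    exact mul_le_mul_of_nonneg_left (pow_le_pow_of_le_one hx0.le hx1 ht') (by positivity)
  have h4 : x ^ m * (p / x + (1 - p)) ^ s.card ≤ Real.exp (-(m - μ) ^ 2 / (2 * m)) := by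
    have e1 : p / x + (1 - p) ≤ Real.exp (p * (1 / x - 1)) := by
      refine le_trans (le_of_eq ?_) (Real.add_one_le_exp _)
      field_simp; ring
    have e2 : (p / x + (1 - p)) ^ s.card ≤ Real.exp (μ * (1 / x - 1)) := by
      refine (pow_le_pow_left₀ (by positivity) e1 _).trans ?_
      rw [← Real.exp_nat_mul, ← mul_assoc]
      have : 0 ≤ 1 / x - 1 := sub_nonneg.2 ((one_le_div hx0).2 hx1)
      exact Real.exp_le_exp.2 (mul_le_mul_of_nonneg_right hμ this)
    have e3 : x ^ m ≤ Real.exp (m * (x - 1 - (1 - x) ^ 2 / 2)) := by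
      rw [← Real.exp_log hx0, Real.exp_log hx0, ← Real.exp_log (pow_pos hx0 m), Real.log_pow]
      exact Real.exp_le_exp.2 (mul_le_mul_of_nonneg_left (log_le_of_le_one hx0 hx1) hm.le)
    -- As `μ / x = m`, the linear terms cancel and `-m (1 - x)² / 2 = -(m - μ)² / (2m)` remains.
    refine (mul_le_mul e3 e2 (by positivity) (by positivity)).trans (le_of_eq ?_)
    rw [← Real.exp_add, hx]
    congr 1
    field_simp
    ring
  linarith

/-- Sets are paired by whether they contain `i`. The strict bound on `|t|` keeps both members of the
pair within size `m`; the only terms lost are those with `|t| = m`. -/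
theorem sum_filter_card_ge_sum_erase {n m : ℕ} (i : Fin n) {g : Finset (Fin n) → ℝ}
    (hg : ∀ S, 0 ≤ g S) :
    ∑ t ∈ (Finset.univ.erase i).powerset with t.card < m, (g t + g (insert i t)) ≤
      ∑ S with S.card ≤ m, g S := by
  have h := Finset.sum_powerset_insert (Finset.notMem_erase i Finset.univ)
    fun S => if S.card ≤ m then g S else 0
  rw [Finset.insert_erase (Finset.mem_univ i), Finset.powerset_univ, ← Finset.sum_add_distrib] at h
  rw [Finset.sum_filter, Finset.sum_filter, h]
  refine Finset.sum_le_sum fun t ht => ?_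
  have hi : i ∉ t := fun hi => Finset.notMem_erase i _ (Finset.mem_powerset.1 ht hi)
  rw [Finset.card_insert_of_notMem hi]
  split_ifs with h1 h2 h3 <;> first | omega | positivity | skip
  all_goals first | exact le_rfl | (have := hg t; have := hg (insert i t); linarith)

/-! ### Node sets, incident edges and the Bayes risk. -/

section Edges

open scoped NNReal

variable {n : ℕ}

/-- The edges, loops included, with at least one endpoint in `S`. -/
def incidentEdges (S : Finset (Fin n)) : Finset (Sym2 (Fin n)) :=
  Finset.univ.filter fun e => ∃ a ∈ S, a ∈ e

theorem incidentEdges_mono {S S' : Finset (Fin n)} (h : S ⊆ S') :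
    incidentEdges S ⊆ incidentEdges S' := fun e he => by
  simp only [incidentEdges, Finset.mem_filter, Finset.mem_univ, true_and] at he ⊢
  exact he.imp fun a ha => ⟨h ha.1, ha.2⟩

theorem mk_mem_incidentEdges {S : Finset (Fin n)} {i j : Fin n} :
    s(i, j) ∈ incidentEdges S ↔ i ∈ S ∨ j ∈ S := by
  simp only [incidentEdges, Finset.mem_filter, Finset.mem_univ, true_and, Sym2.mem_iff]
  aesop

theorem card_incidentEdges_sdiff_le (i : Fin n) (S : Finset (Fin n)) :
    (incidentEdges (insert i S) \ incidentEdges S).card ≤ n := by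
  have h : incidentEdges (insert i S) \ incidentEdges S ⊆ Finset.univ.image fun j => s(i, j) := by
    intro e
    induction e with | _ a b
    simp only [Finset.mem_sdiff, mk_mem_incidentEdges, Finset.mem_insert, Finset.mem_image,
      Finset.mem_univ, true_and]
    rintro ⟨h1, h2⟩
    rcases h1 with (h1 | h1) | (h1 | h1)
    · exact ⟨b, by rw [h1]⟩
    · tauto
    · exact ⟨a, by rw [h1, Sym2.eq_swap]⟩
    · tauto
  simpa using (Finset.card_le_card h).trans Finset.card_image_le

/-- The Bayes risk, for a uniformly random choice of signs, of estimating the indicator of `S`. -/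
theorem signAverage_hamming_eq {N : ℕ} {v : ℝ≥0} (hv : v ≠ 0) (β : ℝ)
    {f : (Fin N → Sym2 (Fin n) → ℝ) → Fin n → ℝ}
    (hf : Measurable f) (h01 : ∀ y i, f y i ∈ Set.Icc (0 : ℝ) 1) (S : Finset (Fin n)) :
    signAverage (fun ε => ∫ y, hammingLoss (f y) (fun i => if i ∈ S then 1 else 0)
      ∂(Measure.pi fun _ : Fin N => Measure.pi fun e =>
        gaussianReal (signedMean β (incidentEdges S) ε e) v)) =
    ∑ i, ∫ y, |f y i - if i ∈ S then 1 else 0| * mixtureDensity v β (incidentEdges S) y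
      ∂noise N (Sym2 (Fin n)) v := by
  have hb : ∀ θ : Sym2 (Fin n) → ℝ, ∀ i, Integrable (fun y => |f y i - if i ∈ S then 1 else 0| *
      shiftDensity v θ y) (noise N (Sym2 (Fin n)) v) := by
    intro θ i
    refine (integrable_shiftDensity hv θ).bdd_mul (c := 1) ?_
      (Filter.Eventually.of_forall fun y => ?_)
    · have : Measurable fun y => f y i := (measurable_pi_apply i).comp hf
      fun_prop
    · rw [Real.norm_eq_abs, abs_abs, abs_le]
      have := h01 y i
      split_ifs <;> constructor <;> linarith [this.1, this.2]
  simp only [integral_pi_gaussianReal hv, hammingLoss, Finset.sum_mul, mixtureDensity,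
    const_mul_signAverage]
  rw [← integral_finsetSum _ fun i _ => integrable_signAverage fun ε => hb _ i]
  simp only [signAverage, ← Finset.mul_sum]
  rw [integral_const_mul, ← integral_finsetSum _ fun ε _ => integrable_finsetSum _ fun i _ => hb _ i]
  congr 2
  ext y
  simp only [Finset.mul_sum]
  rw [Finset.sum_comm]

/-- If an estimator has Hamming risk at most `r` under all signed means supported by at most `m`
nodes, then `r` is at least the Bayes risk for independent nodes of prior probability `p`. -/
theorem mul_sum_le_of_forall_hamming_le {N m : ℕ} {v : ℝ≥0} (hv : v ≠ 0) (β : ℝ) {p r : ℝ}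
    (hp0 : 0 ≤ p) (hp1 : p < 1) (hr : 0 ≤ r) {f : (Fin N → Sym2 (Fin n) → ℝ) → Fin n → ℝ}
    (hf : Measurable f) (h01 : ∀ y i, f y i ∈ Set.Icc (0 : ℝ) 1)
    (hrisk : ∀ S : Finset (Fin n), S.card ≤ m → ∀ ε : Sym2 (Fin n) → Bool,
      ∫ y, hammingLoss (f y) (fun i => if i ∈ S then 1 else 0)
        ∂(Measure.pi fun _ : Fin N => Measure.pi fun e =>
          gaussianReal (signedMean β (incidentEdges S) ε e) v) ≤ r) :
    (∑ i : Fin n, ∑ t ∈ (Finset.univ.erase i).powerset with t.card < m,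
      p ^ t.card * (1 - p) ^ ((Finset.univ.erase i).card - t.card)) *
      (p - p ^ 2 / (4 * (1 - p)) * Real.cosh (N * β ^ 2 / v) ^ n) ≤ r := by
  have hq : 0 < 1 - p := by linarith
  set w : Finset (Fin n) → ℝ := fun S => p ^ S.card * (1 - p) ^ (n - S.card) with hw
  have hw0 : ∀ S, 0 ≤ w S := fun S => by positivity
  set ρ : Finset (Fin n) → Fin n → ℝ := fun S i => ∫ y, |f y i - if i ∈ S then 1 else 0| *
    mixtureDensity v β (incidentEdges S) y ∂noise N (Sym2 (Fin n)) v with hρ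
  have hρ0 : ∀ S i, 0 ≤ ρ S i := fun S i =>
    integral_nonneg fun y => mul_nonneg (abs_nonneg _) (mixtureDensity_nonneg _ _ _ _)
  have hS : ∀ S : Finset (Fin n), S.card ≤ m → ∑ i, ρ S i ≤ r := fun S hS => by
    rw [← signAverage_hamming_eq hv β hf h01 S]
    exact signAverage_le (hrisk S hS)
  -- The truncated prior is not renormalised: mass at most one suffices, since `r ≥ 0`.
  have hw1 : ∑ S with S.card ≤ m, w S ≤ 1 := by
    have h := Fintype.sum_pow_mul_eq_add_pow (Fin n) p (1 - p)
    rw [add_sub_cancel, one_pow, Fintype.card_fin] at h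
    rw [← h]
    exact Finset.sum_le_sum_of_subset_of_nonneg (Finset.filter_subset _ _) fun S _ _ => hw0 S
  have h1 : ∑ i, ∑ S with S.card ≤ m, w S * ρ S i ≤ r := by
    rw [Finset.sum_comm]
    calc ∑ S with S.card ≤ m, ∑ i, w S * ρ S i ≤ ∑ S with S.card ≤ m, w S * r := by
          refine Finset.sum_le_sum fun S h => ?_
          rw [← Finset.mul_sum]
          exact mul_le_mul_of_nonneg_left (hS S (Finset.mem_filter.1 h).2) (hw0 S)
      _ = (∑ S with S.card ≤ m, w S) * r := (Finset.sum_mul _ _ _).symm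
      _ ≤ r := mul_le_of_le_one_left hr hw1
  refine le_trans ?_ h1
  rw [Finset.sum_mul]
  refine Finset.sum_le_sum fun i _ => ?_
  refine le_trans ?_ (sum_filter_card_ge_sum_erase i fun S => mul_nonneg (hw0 S) (hρ0 S i))
  rw [Finset.sum_mul]
  refine Finset.sum_le_sum fun t ht => ?_
  have hti := Finset.mem_powerset.1 (Finset.mem_filter.1 ht).1
  have hi : i ∉ t := fun hi => Finset.notMem_erase i _ (hti hi)
  have hc := Finset.card_le_card hti
  have hn : 0 < n := i.pos
  rw [Finset.card_erase_of_mem (Finset.mem_univ i), Finset.card_univ, Fintype.card_fin] at hc ⊢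
  have key := le_bayes_testing_risk (N := N) hv β
    (Finset.disjoint_sdiff (s := incidentEdges t) (t := incidentEdges (insert i t))) hp1
    (f := fun y => f y i) ((measurable_pi_apply i).comp hf) (fun y => h01 y i)
  rw [Finset.union_sdiff_of_subset (incidentEdges_mono (Finset.subset_insert i t))] at key
  have r1 : ρ (insert i t) i = ∫ y, (1 - f y i) * mixtureDensity v β (incidentEdges (insert i t)) y
      ∂noise N (Sym2 (Fin n)) v := by
    simp only [hρ, Finset.mem_insert_self, if_true]
    congr 1; ext y
    rw [abs_sub_comm, abs_of_nonneg (by linarith [(h01 y i).2])]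
  have r0 : ρ t i = ∫ y, f y i * mixtureDensity v β (incidentEdges t) y
      ∂noise N (Sym2 (Fin n)) v := by
    simp only [hρ, hi, if_false, sub_zero]
    congr 1; ext y
    rw [abs_of_nonneg (h01 y i).1]
  rw [← r1, ← r0] at key
  have hcosh := pow_le_pow_right₀ (Real.one_le_cosh (N * β ^ 2 / v))
    (card_incidentEdges_sdiff_le i t)
  -- The two prior weights share the weight of `t` among the other `n - 1` nodes, leaving `p` and `1
  -- - p` as the prior of the test for `i`.
  have w1 : w (insert i t) = p ^ t.card * (1 - p) ^ (n - 1 - t.card) * p := by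
    simp only [hw, Finset.card_insert_of_notMem hi]
    rw [show n - (t.card + 1) = n - 1 - t.card by omega]; ring
  have w0 : w t = p ^ t.card * (1 - p) ^ (n - 1 - t.card) * (1 - p) := by
    simp only [hw]
    rw [show n - t.card = n - 1 - t.card + 1 by omega]; ring
  rw [w1, w0, mul_assoc _ (1 - p), mul_assoc _ p, ← mul_add]
  refine mul_le_mul_of_nonneg_left ?_ (by positivity)
  have hc0 : 0 ≤ p ^ 2 / (4 * (1 - p)) := by positivity
  have := mul_le_mul_of_nonneg_left hcosh hc0
  linarith

end Edges

/-! ### From the Bayes bound to the minimax risk. -/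

open scoped NNReal

variable {n : ℕ}

theorem signedMean_sq {E : Type*} [DecidableEq E] (β : ℝ) {A : Finset E} (ε : E → Bool) {e : E}
    (he : e ∈ A) : signedMean β A ε e ^ 2 = β ^ 2 := by
  simp only [signedMean, he, if_true]
  split_ifs <;> ring

/-- Rows in `S` have all `n > m` entries equal to `± β`, so the support is identified. At least `n -
m > 2n/3` of them count towards the norm condition, whence `3 b² ≤ 2 n β²`. -/
theorem signedMean_mem_nodeSparse {m : ℕ} {b β : ℝ} (hm : (m : ℝ) < n / 3) (hβ : β ≠ 0)
    (hb : 3 * b ^ 2 ≤ 2 * n * β ^ 2) {S : Finset (Fin n)} (hS : S.card ≤ m)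
    (ε : Sym2 (Fin n) → Bool) {B : Matrix (Fin n) (Fin n) ℝ}
    (hB : ∀ i j, B i j = signedMean β (incidentEdges S) ε s(i, j)) :
    B ∈ nodeSparse b n m ∧ nodeSupport B = S := by
  have hsq : ∀ i ∈ S, ∀ j, B i j ^ 2 = β ^ 2 := fun i hi j => by
    rw [hB, signedMean_sq β ε (mk_mem_incidentEdges.2 (Or.inl hi))]
  have hβ2 : 0 < β ^ 2 := by positivity
  have hzero : ∀ i ∉ S, ∀ j ∉ S, B i j = 0 := fun i hi j hj => by
    rw [hB, signedMean, if_neg]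
    rw [mk_mem_incidentEdges]; tauto
  have hmn : m < n := by
    have h0 : (0 : ℝ) ≤ n := n.cast_nonneg
    exact_mod_cast (show (m : ℝ) < n by linarith)
  have hcover : IsNodeCover B S := by
    refine ⟨fun i hi => Real.sqrt_pos.2 ?_, hzero⟩
    simp only [hsq i hi]
    exact Finset.sum_pos (fun _ _ => hβ2) ⟨i, Finset.mem_univ i⟩
  have hrow : ∀ i ∈ S, m + 1 ≤ (Finset.univ.filter fun j => B i j ≠ 0).card := fun i hi => by
    rw [Finset.filter_true_of_mem, Finset.card_univ, Fintype.card_fin]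
    · exact hmn
    · intro j _ h
      have := hsq i hi j
      rw [h, zero_pow two_ne_zero] at this
      exact hβ2.ne this
  have hsupp : nodeSupport B = S := nodeSupport_eq_of_rows hcover hS hrow
  refine ⟨⟨?_, ?_, ?_, ?_, ?_⟩, hsupp⟩
  · ext i j
    rw [Matrix.transpose_apply, hB, hB, Sym2.eq_swap]
  · rwa [hsupp]
  · rw [hsupp]
    intro i hi
    refine Real.le_sqrt_of_sq_le ?_
    simp only [hsq i hi, Finset.sum_const, nsmul_eq_mul]
    have h1 : n - m ≤ (insert i Sᶜ).card := by
      have h2 := Finset.card_le_card (Finset.subset_insert i Sᶜ)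
      rw [Finset.card_compl, Fintype.card_fin] at h2
      omega
    have h3 : (n : ℝ) - m ≤ ((insert i Sᶜ).card : ℝ) := by
      rw [← Nat.cast_sub hmn.le]; exact_mod_cast h1
    nlinarith
  · rwa [hsupp]
  · rwa [hsupp]

theorem observationLaw_eq_map {σ : ℝ} {θ : Sym2 (Fin n) → ℝ} {B : Matrix (Fin n) (Fin n) ℝ}
    (hB : ∀ i j, B i j = θ s(i, j)) :
    observationLaw σ B = (Measure.pi fun e => gaussianReal (θ e) (σ ^ 2).toNNReal).map
      fun g i j => g s(i, j) := by
  have h : (Measure.pi fun e => gaussianReal (θ e) (σ ^ 2).toNNReal) =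
      (Measure.pi fun _ : Sym2 (Fin n) => gaussianReal 0 (σ ^ 2).toNNReal).map
        fun g e => θ e + g e := by
    have h0 : ∀ e, (gaussianReal 0 (σ ^ 2).toNNReal).map (fun x => θ e + x) =
        gaussianReal (θ e) (σ ^ 2).toNNReal := fun e => by
      rw [gaussianReal_map_const_add, zero_add]
    have (e : Sym2 (Fin n)) :
        SigmaFinite ((gaussianReal 0 (σ ^ 2).toNNReal).map fun x => θ e + x) := by
      rw [h0]; infer_instance
    rw [Measure.pi_map_pi (f := fun e x => θ e + x) fun e => by fun_prop]
    simp only [h0]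
  rw [h, Measure.map_map (by fun_prop) (by fun_prop), observationLaw]
  congr 1
  ext g i j
  simp [hB]

instance (σ : ℝ) (B : Matrix (Fin n) (Fin n) ℝ) : IsProbabilityMeasure (observationLaw σ B) :=
  Measure.isProbabilityMeasure_map (measurable_pi_lambda _ fun i =>
    measurable_pi_lambda _ fun j => by fun_prop).aemeasurable

theorem samplesLaw_eq_map {N : ℕ} {σ : ℝ} {θ : Sym2 (Fin n) → ℝ} {B : Matrix (Fin n) (Fin n) ℝ}
    (hB : ∀ i j, B i j = θ s(i, j)) :
    samplesLaw N σ B = (Measure.pi fun _ : Fin N => Measure.pi fun e =>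
      gaussianReal (θ e) (σ ^ 2).toNNReal).map fun y l i j => y l s(i, j) := by
  have h := observationLaw_eq_map (σ := σ) hB
  have (_ : Fin N) : SigmaFinite ((Measure.pi fun e => gaussianReal (θ e) (σ ^ 2).toNNReal).map
      fun (g : Sym2 (Fin n) → ℝ) (i j : Fin n) => g s(i, j)) := by
    rw [← h]; infer_instance
  rw [samplesLaw, h, Measure.pi_map_pi (μ := fun _ : Fin N => Measure.pi fun e =>
    gaussianReal (θ e) (σ ^ 2).toNNReal)
    (f := fun _ (g : Sym2 (Fin n) → ℝ) (i j : Fin n) => g s(i, j)) fun _ =>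
    (measurable_pi_lambda _ fun i => measurable_pi_lambda _ fun j => by fun_prop).aemeasurable]

/-- Any estimator from `Y` applies to a sample of size one, so lower bounds proved for `samplesLaw
1` transfer. -/
theorem minimaxRisk_samplesLaw_one_le (σ : ℝ) (S : Set (Matrix (Fin n) (Fin n) ℝ)) :
    hammingMinimaxRisk (samplesLaw 1 σ) S ≤ hammingMinimaxRisk (observationLaw σ) S := by
  refine le_iInf fun T => iInf_le_of_le ⟨fun y => T.1 (y 0), T.2.1.comp (measurable_pi_apply 0),
    fun y => T.2.2 (y 0)⟩ (iSup₂_mono fun B _ => ?_)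
  have h := measurePreserving_eval (fun _ : Fin 1 => observationLaw σ B) 0
  have hT := T.2.1
  conv_rhs => rw [← h.map_eq]
  rw [lintegral_map _ h.measurable]
  · rfl
  · unfold hammingLoss
    have : ∀ i, Measurable fun y => T.1 y i := fun i => (measurable_pi_apply i).comp hT
    fun_prop

/-- The common source of all three bounds, with `β` and the second-moment bound `K` left free. The
condition `hK'` makes the last factor nonnegative, as needed to multiply by the Chernoff bound. -/
theorem ofReal_le_minimaxRisk_samplesLaw {m N : ℕ} {b σ β μ K : ℝ} (hm : (m : ℝ) < n / 3)
    (hσ : 0 < σ) (hβ : β ≠ 0) (hb : 3 * b ^ 2 ≤ 2 * n * β ^ 2) (hμ : μ ∈ Set.Ioc (0 : ℝ) m)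
    (hK : Real.exp (n * N ^ 2 * β ^ 4 / (2 * σ ^ 4)) ≤ K) (hK' : μ / n * K ≤ 8 / 3) :
    ENNReal.ofReal (μ * (1 - Real.exp (-(m - μ) ^ 2 / (2 * m))) * (1 - 3 / 8 * (μ / n * K))) ≤
      hammingMinimaxRisk (samplesLaw N σ) (nodeSparse b n m) := by
  obtain ⟨hμ0, hμm⟩ := hμ
  have hn : (0 : ℝ) < n := by linarith
  set v : ℝ≥0 := (σ ^ 2).toNNReal
  have hvσ : (v : ℝ) = σ ^ 2 := Real.coe_toNNReal _ (by positivity)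
  have hv : v ≠ 0 := by
    intro h
    rw [h] at hvσ
    exact (by positivity : σ ^ 2 ≠ 0) hvσ.symm
  set p : ℝ := μ / n with hp
  have hp0 : 0 < p := by positivity
  have hp3 : p ≤ 1 / 3 := by
    rw [hp, div_le_iff₀ hn]; linarith
  refine le_iInf fun T => ?_
  set R := ⨆ B ∈ nodeSparse b n m,
    ∫⁻ y, ENNReal.ofReal (hammingLoss (T.1 y) (supportIndicator B)) ∂samplesLaw N σ B with hR
  rcases eq_or_ne R ⊤ with hR' | hR'
  · rw [hR']; exact le_top
  have hT : ∀ i, Measurable fun y => T.1 y i := fun i => (measurable_pi_apply i).comp T.2.1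
  have hloss : ∀ x : Fin n → ℝ, Measurable fun y => hammingLoss (T.1 y) x := fun x => by
    unfold hammingLoss; fun_prop
  have hloss0 : ∀ x y : Fin n → ℝ, 0 ≤ hammingLoss x y := fun x y =>
    Finset.sum_nonneg fun _ _ => abs_nonneg _
  set Φ : (Fin N → Sym2 (Fin n) → ℝ) → Fin N → Fin n → Fin n → ℝ := fun y l i j => y l s(i, j)
  have hΦ : Measurable Φ := by fun_prop
  have key := mul_sum_le_of_forall_hamming_le (m := m) hv β hp0.le (by linarith)
    (ENNReal.toReal_nonneg (a := R)) (f := fun y => T.1 (Φ y))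
    (T.2.1.comp hΦ) (fun y i => T.2.2 (Φ y) i) ?_
  swap
  · intro S hS ε
    set B : Matrix (Fin n) (Fin n) ℝ := fun i j => signedMean β (incidentEdges S) ε s(i, j)
    obtain ⟨hBmem, hBS⟩ := signedMean_mem_nodeSparse hm hβ hb hS ε (B := B) fun _ _ => rfl
    have hind : supportIndicator B = fun i => if i ∈ S then 1 else 0 := by
      ext i; rw [supportIndicator, hBS]
    have h1 := le_iSup₂ (f := fun B (_ : B ∈ nodeSparse b n m) => ∫⁻ y,
      ENNReal.ofReal (hammingLoss (T.1 y) (supportIndicator B)) ∂samplesLaw N σ B) B hBmem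
    rw [← hR, samplesLaw_eq_map (B := B) (θ := signedMean β (incidentEdges S) ε) fun _ _ => rfl,
      lintegral_map (hloss _).ennreal_ofReal hΦ, hind] at h1
    refine (integral_eq_lintegral_of_nonneg_ae (Filter.Eventually.of_forall fun y => hloss0 _ _)
      ((hloss _).comp hΦ).aestronglyMeasurable).trans_le ?_
    exact ENNReal.toReal_mono hR' h1
  refine ENNReal.ofReal_le_of_le_toReal (le_trans ?_ key)
  have hcosh : Real.cosh (N * β ^ 2 / v) ^ n ≤ K := by
    refine le_trans ?_ hK
    refine (pow_le_pow_left₀ (Real.cosh_pos _).le (Real.cosh_le_exp_half_sq _) n).trans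
      (le_of_eq ?_)
    rw [← Real.exp_nat_mul, hvσ]
    congr 1
    field_simp
  have hK0 : 0 < K := (Real.exp_pos _).trans_le hK
  have h1 : p * (1 - 3 / 8 * (p * K)) ≤
      p - p ^ 2 / (4 * (1 - p)) * Real.cosh (N * β ^ 2 / v) ^ n := by
    -- `p ≤ 1/3` gives `4 (1 - p) ≥ 8/3`.
    have h2 : p ^ 2 / (4 * (1 - p)) ≤ 3 / 8 * p ^ 2 := by
      rw [div_le_iff₀ (by linarith)]
      nlinarith [sq_nonneg p]
    have h3 := mul_le_mul h2 hcosh (by positivity) (by positivity)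
    linarith
  have h2 : (n : ℝ) * (1 - Real.exp (-(m - μ) ^ 2 / (2 * m))) ≤
      ∑ i : Fin n, ∑ t ∈ (Finset.univ.erase i).powerset with t.card < m,
        p ^ t.card * (1 - p) ^ ((Finset.univ.erase i).card - t.card) := by
    have h := Finset.card_nsmul_le_sum (Finset.univ : Finset (Fin n)) (fun i =>
      ∑ t ∈ (Finset.univ.erase i).powerset with t.card < m,
        p ^ t.card * (1 - p) ^ ((Finset.univ.erase i).card - t.card))
      (1 - Real.exp (-(m - μ) ^ 2 / (2 * m))) fun i _ =>
        one_sub_exp_le_sum_powerset _ hp0.le (by linarith) hμ0 ?_ hμm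
    · simpa using h
    · have hc : ((Finset.univ.erase i).card : ℝ) ≤ n := by
        exact_mod_cast (Finset.card_le_univ _).trans_eq (Fintype.card_fin n)
      calc _ ≤ n * p := mul_le_mul_of_nonneg_right hc hp0.le
        _ = μ := by rw [hp]; field_simp
  have h3 : 0 ≤ p * (1 - 3 / 8 * (p * K)) := mul_nonneg hp0.le (by linarith)
  have h4 : 0 ≤ 1 - Real.exp (-(m - μ) ^ 2 / (2 * m)) := by
    rw [sub_nonneg, Real.exp_le_one_iff]
    exact div_nonpos_of_nonpos_of_nonneg (by nlinarith [sq_nonneg ((m : ℝ) - μ)]) (by positivity)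
  have h5 : μ = n * p := by rw [hp]; field_simp
  calc _ = (n * (1 - Real.exp (-(m - μ) ^ 2 / (2 * m)))) * (p * (1 - 3 / 8 * (p * K))) := by
        linear_combination
          ((1 - Real.exp (-(m - μ) ^ 2 / (2 * m))) * (1 - 3 / 8 * (p * K))) * h5
    _ ≤ _ := mul_le_mul h2 h1 h3 (le_trans (by positivity) h2)

/-! ### Choice of the signal size and the final constants. -/

theorem exists_pos_pow_four_eq {c : ℝ} (hc : 0 < c) : ∃ β > 0, β ^ 4 = c :=
  ⟨√√c, by positivity, by
    rw [show (4 : ℕ) = 2 * 2 from rfl, pow_mul, Real.sq_sqrt (by positivity), Real.sq_sqrt hc.le]⟩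

/-- Only the third exponential of `fRate` is used; the other two merely lower it. For `b > 0` the
smallest admissible `β² = 3b² / (2n)` makes the second-moment bound `K` the square root of that
exponential, which fixes `C = 9/4`. -/
theorem ofReal_fRate_le_minimaxRisk {m : ℕ} {b σ μ : ℝ} (hm : (m : ℝ) < n / 3) (hb : 0 ≤ b)
    (hσ : 0 < σ) (hμ : μ ∈ Set.Ioc (0 : ℝ) m) :
    ENNReal.ofReal (4 * μ * (1 / 16 * fRate 1 n (9 / 4 * b ^ 4 / σ ^ 4) μ
        - Real.exp (-(m - μ) ^ 2 / (2 * m)))) ≤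
      hammingMinimaxRisk (samplesLaw 1 σ) (nodeSparse b n m) := by
  obtain ⟨hμ0, hμm⟩ := hμ
  have hn : (0 : ℝ) < n := by linarith
  have hp0 : 0 < μ / n := by positivity
  have hp3 : μ / n ≤ 1 / 3 := by
    rw [div_le_iff₀ hn]; linarith
  have hf : fRate 1 n (9 / 4 * b ^ 4 / σ ^ 4) μ ≤
      3 - μ / n * Real.exp (9 / 4 * b ^ 4 / σ ^ 4 / n) := by
    rw [fRate, one_mul, one_mul]
    have h1 := Real.exp_pos (9 / 4 * b ^ 4 / σ ^ 4 - n * Real.log (n / (3 * μ)))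
    have h2 := Real.exp_pos (9 / 4 * b ^ 4 / σ ^ 4 / Real.log n - n)
    have := mul_pos hp0 (add_pos h1 h2)
    linarith
  obtain ⟨β, hβ, hβb, K, hK, hK1⟩ : ∃ β : ℝ, 0 < β ∧ 3 * b ^ 2 ≤ 2 * n * β ^ 2 ∧ ∃ K : ℝ,
      Real.exp (n * (1 : ℕ) ^ 2 * β ^ 4 / (2 * σ ^ 4)) ≤ K ∧
        (K = 2 ∨ K ^ 2 = Real.exp (9 / 4 * b ^ 4 / σ ^ 4 / n)) := by
    -- For `b = 0` the smallest admissible `β` would be zero and the support empty, so a small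
    -- positive `β` is used, with `K = 2 ≥ exp (1/2)`.
    rcases hb.eq_or_lt with rfl | hb
    · obtain ⟨β, hβ, h4⟩ := exists_pos_pow_four_eq (c := σ ^ 4 / n) (by positivity)
      refine ⟨β, hβ, by simp; positivity, 2, ?_, Or.inl rfl⟩
      rw [h4, ← Real.le_log_iff_exp_le two_pos]
      refine le_trans (le_of_eq ?_) (le_trans (by norm_num : (1 / 2 : ℝ) ≤ 0.6931471803)
        Real.log_two_gt_d9.le)
      push_cast
      field_simp
    · refine ⟨b * √(3 / (2 * n)), by positivity, ?_, _, le_rfl, Or.inr ?_⟩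
      · rw [mul_pow, Real.sq_sqrt (by positivity)]
        refine le_of_eq ?_
        field_simp
      · rw [← Real.exp_nat_mul, mul_pow, show √(3 / (2 * (n : ℝ))) ^ 4 = (3 / (2 * n)) ^ 2 by
          rw [show (4 : ℕ) = 2 * 2 from rfl, pow_mul, Real.sq_sqrt (by positivity)]]
        congr 1
        push_cast
        field_simp
        norm_num
  set X := Real.exp (9 / 4 * b ^ 4 / σ ^ 4 / n) with hX
  have hX0 : 0 < X := Real.exp_pos _
  have hK0 : 0 < K := (Real.exp_pos _).trans_le hK
  set δ := Real.exp (-(m - μ) ^ 2 / (2 * m)) with hδ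
  have hδ0 : 0 < δ := Real.exp_pos _
  rcases le_or_gt (μ / n * K) (8 / 3) with h | h
  · refine le_trans (ENNReal.ofReal_le_ofReal ?_)
      (ofReal_le_minimaxRisk_samplesLaw hm hσ hβ.ne' hβb ⟨hμ0, hμm⟩ hK h)
    have h1 : 3 / 8 * (μ / n * K) ≤ 1 / 4 + μ / n * X / 4 := by
      rcases hK1 with h1 | h1
      · rw [h1]; nlinarith
      · rw [← h1]; nlinarith [mul_nonneg hp0.le (sq_nonneg (K - 1))]
    have h2 : 0 ≤ δ * (3 / 8 * (μ / n * K)) := by positivity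
    have h3 : 4 * (1 / 16 * fRate 1 n (9 / 4 * b ^ 4 / σ ^ 4) μ - δ) ≤
        (1 - δ) * (1 - 3 / 8 * (μ / n * K)) := by linarith
    have := mul_le_mul_of_nonneg_left h3 hμ0.le
    linarith
  -- For large `K` the claim is void: `K > 8` excludes `K = 2`, and `(μ / n) K² ≥ 3` makes `fRate`
  -- nonpositive.
  · rw [ENNReal.ofReal_of_nonpos]
    · exact zero_le
    · have hK8 : 8 < K := by nlinarith
      have h1 : K ^ 2 = X := hK1.resolve_left (by linarith)
      refine mul_nonpos_of_nonneg_of_nonpos (by positivity) ?_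
      have : 3 ≤ μ / n * X := by rw [← h1]; nlinarith
      linarith

theorem ofReal_le_minimaxRisk_of_lt_threshold {m N : ℕ} {b σ μ : ℝ} (hm : (m : ℝ) < n / 3)
    (hN : 1 ≤ N) (hb : 0 ≤ b) (hσ : 0 < σ) (hμ : μ ∈ Set.Icc (1 : ℝ) m)
    (hlt : b < 1 / 2 * σ * (n : ℝ) ^ (1 / 4 : ℝ) * Real.log (n / (3 * μ)) ^ (1 / 4 : ℝ) / √N) :
    ENNReal.ofReal (4 * μ * (1 / 8 - Real.exp (-(m - μ) ^ 2 / (2 * m)))) ≤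
      hammingMinimaxRisk (samplesLaw N σ) (nodeSparse b n m) := by
  obtain ⟨hμ1, hμm⟩ := hμ
  have hμ0 : 0 < μ := by linarith
  have hn : (0 : ℝ) < n := by linarith
  have hN0 : (0 : ℝ) < N := by exact_mod_cast hN
  set L := Real.log (n / (3 * μ)) with hL
  have hL0 : 0 < L := Real.log_pos ((one_lt_div (by positivity)).2 (by linarith))
  have hrt : ∀ x : ℝ, 0 ≤ x → (x ^ (1 / 4 : ℝ)) ^ 4 = x := fun x hx => by
    rw [← Real.rpow_natCast, ← Real.rpow_mul hx]; norm_num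
  have hb4 : b ^ 4 ≤ 1 / 16 * σ ^ 4 * n * L / N ^ 2 := by
    refine (pow_le_pow_left₀ hb hlt.le 4).trans (le_of_eq ?_)
    rw [div_pow, mul_pow, mul_pow, mul_pow, hrt _ hn.le, hrt _ hL0.le,
      show √(N : ℝ) ^ 4 = N ^ 2 by
        rw [show (4 : ℕ) = 2 * 2 from rfl, pow_mul, Real.sq_sqrt hN0.le]]
    norm_num
  -- This is `9 / (4 n²)` times the bound on `b ^ 4`, so equality holds in the norm condition at the
  -- threshold. The exponent in `hK` becomes `9/128 * L ≤ L`.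
  obtain ⟨β, hβ, h4⟩ := exists_pos_pow_four_eq (c := 9 / 64 * σ ^ 4 * L / (n * N ^ 2))
    (by positivity)
  have hβb : 3 * b ^ 2 ≤ 2 * n * β ^ 2 := by
    refine le_of_sq_le_sq ?_ (by positivity)
    calc (3 * b ^ 2) ^ 2 = 9 * b ^ 4 := by ring
      _ ≤ 9 * (1 / 16 * σ ^ 4 * n * L / N ^ 2) := by linarith
      _ = 4 * n ^ 2 * (9 / 64 * σ ^ 4 * L / (n * N ^ 2)) := by field_simp; norm_num
      _ = (2 * n * β ^ 2) ^ 2 := by rw [← h4]; ring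
  have hK : Real.exp (n * N ^ 2 * β ^ 4 / (2 * σ ^ 4)) ≤ n / (3 * μ) := by
    rw [← Real.le_log_iff_exp_le (by positivity), h4, ← hL]
    have : (n : ℝ) * N ^ 2 * (9 / 64 * σ ^ 4 * L / (n * N ^ 2)) / (2 * σ ^ 4) = 9 / 128 * L := by
      field_simp; norm_num
    linarith
  -- The last factor is thus `7/8`, and `(1 - δ) * 7/8 ≥ 4 * (1/8 - δ)` for `δ ≥ 0`.
  have hpK : μ / n * (n / (3 * μ)) = 1 / 3 := by field_simp
  refine le_trans (ENNReal.ofReal_le_ofReal ?_) (ofReal_le_minimaxRisk_samplesLaw hm hσ hβ.ne' hβb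
    ⟨hμ0, hμm⟩ hK (by rw [hpK]; norm_num))
  rw [hpK]
  have hδ := Real.exp_pos (-(m - μ) ^ 2 / (2 * m))
  nlinarith

theorem theorem4p2 :
    -- one observation, bound in terms of `f_n`
    (∃ C > (0 : ℝ), ∃ C' > (0 : ℝ), ∃ n₀ : ℕ, ∀ n ≥ n₀, ∀ (m : ℕ) (b σ : ℝ),
      (m : ℝ) < n / 3 → 0 ≤ b → 0 < σ → ∀ m' ∈ Set.Ioc (0 : ℝ) m,
        ENNReal.ofReal (4 * m' * (1 / 16 * fRate C' n (C * b ^ 4 / σ ^ 4) m'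
            - Real.exp (-(m - m') ^ 2 / (2 * m))))
          ≤ hammingMinimaxRisk (observationLaw σ) (nodeSparse b n m)) ∧
    -- one observation, signal strength below the threshold
    (∃ C > (0 : ℝ), ∀ (n m : ℕ) (b σ : ℝ),
      (m : ℝ) < n / 3 → 0 ≤ b → 0 < σ → ∀ m' ∈ Set.Icc (1 : ℝ) m,
        b < C * σ * (n : ℝ) ^ (1 / 4 : ℝ) * Real.log (n / (3 * m')) ^ (1 / 4 : ℝ) →
        ENNReal.ofReal (4 * m' * (1 / 8 - Real.exp (-(m - m') ^ 2 / (2 * m))))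
          ≤ hammingMinimaxRisk (observationLaw σ) (nodeSparse b n m)) ∧
    -- `N` independent observations, signal strength below the threshold
    (∃ C > (0 : ℝ), ∃ n₀ : ℕ, ∀ n ≥ n₀, ∀ (m N : ℕ) (b σ : ℝ),
      (m : ℝ) < n / 3 → 1 ≤ N → 0 ≤ b → 0 < σ → ∀ m' ∈ Set.Icc (1 : ℝ) m,
        b < C * σ * (n : ℝ) ^ (1 / 4 : ℝ) * Real.log (n / (3 * m')) ^ (1 / 4 : ℝ) / √N →
        ENNReal.ofReal (4 * m' * (1 / 8 - Real.exp (-(m - m') ^ 2 / (2 * m))))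
          ≤ hammingMinimaxRisk (samplesLaw N σ) (nodeSparse b n m)) := by
  refine ⟨⟨9 / 4, by norm_num, 1, one_pos, 0, fun n _ m b σ hm hb hσ μ hμ =>
      (ofReal_fRate_le_minimaxRisk hm hb hσ hμ).trans (minimaxRisk_samplesLaw_one_le _ _)⟩,
    ⟨1 / 2, by norm_num, fun n m b σ hm hb hσ μ hμ hlt =>
      (ofReal_le_minimaxRisk_of_lt_threshold hm le_rfl hb hσ hμ ?_).trans
        (minimaxRisk_samplesLaw_one_le _ _)⟩,
    ⟨1 / 2, by norm_num, 0, fun n _ m N b σ hm hN hb hσ μ hμ hlt =>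
      ofReal_le_minimaxRisk_of_lt_threshold hm hN hb hσ hμ hlt⟩⟩
  simpa using hlt
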